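/- Let $(V,\circ,u,\langle\cdot,\cdot\rangle)$ be a Euclidean Jordan algebra: a finite-dimensional real inner product space with a commutative bilinear product $\circ$ with unit $u$ such that $x^2\circ(x\circ y)=x\circ(x^2\circ y)$ and $\langle x\circ y,z\rangle=\langle x,y\circ z\rangle$ for all $x,y,z\in V$, where $x^2=x\circ x$. (The inner product need not be normalized; the usual normalization $\langle c,u\rangle=1$ for all primitive idempotents $c$ is a special case.) Put $\operatorname{tr}x=\langle x,u\rangle$ and $P_x(y)=2\,x\circ(x\circ y)-x^2\circ y$. A state is an element $\rho=x^2$, $x\in V$, with $\operatorname{tr}\rho=1$. If $x=\sum_i\lambda_ic_i$ is the spectral decomposition of $x$ (distinct real numbers $\lambda_i$, non-zero idempotents $c_i$ with $c_i\circ c_j=0$ for $i\ne j$ and $\sum_ic_i=u$), put $f(x)=\sum_if(\lambda_i)c_i$; in particular this defines $x^t$ for $x$ in the cone of squares, where for $t<0$ the sum runs only over the $i$ with $\lambda_i\neq0$. The support of $x$ is the idempotent $\operatorname{supp}x=\sum_{\lambda_i\ne0}c_i$, and the support of $\rho$ is contained in that of $\sigma$ if $(\operatorname{supp}\sigma)\circ\rho=\rho$;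 this always holds if $0$ is not an eigenvalue of $\sigma$. For states $\rho,\sigma$ and real $s>0$ define the Petz and the sandwiched relative Rényi entropy by $$D_{1+s}(\rho\|\sigma)=\frac1s\log\operatorname{tr}\bigl(\rho^{1+s}\circ\sigma^{-s}\bigr),\qquad \underline D_{1+s}(\rho\|\sigma)=\frac1s\log\operatorname{tr}\Bigl(\bigl(P_{\sigma^{-s/(2(1+s))}}(\rho)\bigr)^{1+s}\Bigr)$$ if the support of $\rho$ is contained in that of $\sigma$, and by $+\infty$ for both otherwise. Then for all states $\rho,\sigma$ in $V$ and all real $s>0$, $$D_{1+s}(\rho\|\sigma)\;\ge\;\underline D_{1+s}(\rho\|\sigma).$$ -/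

import Mathlib

/-- A (unital) Euclidean Jordan algebra: a finite-dimensional real vector space `V` with a
commutative, bilinear, unital product `*` satisfying the Jordan identity (`IsCommJordan`), and with
an inner product `form` that is associative for the product. No normalization of `form` is imposed;
the inner products with `⟨c, 1⟩ = 1` for every primitive idempotent `c`, for which `tr` below is the
canonical trace, are a special case. -/
class EuclideanJordanAlgebra (V : Type*) [NonAssocCommRing V] [Module ℝ V] extends
    IsCommJordan V, IsScalarTower ℝ V V, SMulCommClass ℝ V V, Module.Finite ℝ V where
  /-- The inner product `⟨x, y⟩`. -/
  form : LinearMap.BilinForm ℝ V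
  form_symm : ∀ x y : V, form x y = form y x
  form_pos : ∀ x : V, x ≠ 0 → 0 < form x x
  form_assoc : ∀ x y z : V, form (x * y) z = form x (y * z)

namespace EuclideanJordanAlgebra

variable {V : Type*} [NonAssocCommRing V] [Module ℝ V]

/-- A complete system of orthogonal idempotents (with no zero member). -/
structure IsCSOI {ι : Type*} [Fintype ι] (c : ι → V) : Prop where
  idem : ∀ i, c i * c i = c i
  ne_zero : ∀ i, c i ≠ 0
  orth : ∀ i j, i ≠ j → c i * c j = 0
  complete : ∑ i, c i = 1

/-- A spectral decomposition `x = ∑ i, eigenvalue i • proj i`, with distinct eigenvalues and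
`proj` a complete system of orthogonal idempotents. -/
structure SpectralDecomposition (x : V) where
  d : ℕ
  eigenvalue : Fin d → ℝ
  proj : Fin d → V
  injective : Function.Injective eigenvalue
  csoi : IsCSOI proj
  eq_sum : x = ∑ i, eigenvalue i • proj i

/-- The value of `f` at `x` read off from one spectral decomposition of `x`. -/
def SpectralDecomposition.apply {x : V} (D : SpectralDecomposition x) (f : ℝ → ℝ) : V :=
  ∑ i, f (D.eigenvalue i) • D.proj i

open Classical in
/-- Functional calculus `f(x) = ∑ i, f (λ i) • c i`, where `x = ∑ i, λ i • c i` is the spectral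
decomposition of `x`. It exists for every element of a Euclidean Jordan algebra (spectral theorem),
so the last branch is never used there, and the value does not depend on the chosen decomposition
(`fn_eq_apply` below). -/
noncomputable def fn (f : ℝ → ℝ) (x : V) : V :=
  if h : Nonempty (SpectralDecomposition x) then h.some.apply f else 0

/-- Real powers `x ^ t` of a positive element. For `t ≠ 0` we have `(0 : ℝ) ^ t = 0`, so for `t < 0`
and singular `x` this is the power of `x` on its support. -/
noncomputable def pow (x : V) (t : ℝ) : V := fn (fun r => r ^ t) x

open Classical in
/-- The support idempotent of `x`: the sum of the spectral idempotents of `x` that belong to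
non-zero eigenvalues. It equals `1` when `0` is not an eigenvalue of `x`. -/
noncomputable def supp (x : V) : V := fn (fun r => if r = 0 then 0 else 1) x

/-- The support of `ρ` is contained in the support of `σ`. -/
def SuppLE (ρ σ : V) : Prop := supp σ * ρ = ρ

/-- The quadratic representation `P_x y = 2 x ∘ (x ∘ y) - x² ∘ y`. -/
def quad (x y : V) : V := (2 : ℝ) • (x * (x * y)) - (x * x) * y

section Euclidean

variable [EuclideanJordanAlgebra V]

/-- The trace `tr x = ⟨x, u⟩`, where `u = 1` is the unit. -/
def tr (x : V) : ℝ := form x 1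

/-- States: elements of the cone of squares with unit trace. -/
def IsState (ρ : V) : Prop := (∃ x : V, ρ = x * x) ∧ tr ρ = 1

open Classical in
/-- The Petz relative Rényi entropy `D_{1+s}(ρ‖σ) = (1/s) log tr (ρ^{1+s} ∘ σ^{-s})` (for `s > 0`),
equal to `+∞` when the support of `ρ` is not contained in that of `σ`. -/
noncomputable def petzRenyi (s : ℝ) (ρ σ : V) : EReal :=
  if SuppLE ρ σ then
    ((1 / s * Real.log (tr (pow ρ (1 + s) * pow σ (-s))) : ℝ) : EReal)
  else ⊤

open Classical in
/-- The sandwiched relative Rényi entropy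
`(1/s) log tr ((P_{σ^{-s/(2(1+s))}} ρ)^{1+s})` (for `s > 0`),
equal to `+∞` when the support of `ρ` is not contained in that of `σ`. -/
noncomputable def sandwichedRenyi (s : ℝ) (ρ σ : V) : EReal :=
  if SuppLE ρ σ then
    ((1 / s * Real.log (tr (pow (quad (pow σ (-s / (2 * (1 + s)))) ρ) (1 + s))) : ℝ) : EReal)
  else ⊤

open Polynomial in
theorem aeval_mulLeft_one {x : V} (D : SpectralDecomposition x) (p : ℝ[X]) :
    aeval (LinearMap.mulLeft ℝ x) p 1 = ∑ i, p.eval (D.eigenvalue i) • D.proj i := by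
  induction p using Polynomial.induction_on' with
  | add p q hp hq => simp [hp, hq, add_smul, Finset.sum_add_distrib]
  | monomial n a =>
    have key : ((LinearMap.mulLeft ℝ x) ^ n) 1 = ∑ i, (D.eigenvalue i ^ n) • D.proj i := by
      induction n with
      | zero => simp [D.csoi.complete]
      | succ n ih =>
        rw [pow_succ', Module.End.mul_apply, ih, LinearMap.mulLeft_apply]
        refine (congrArg (fun y => y * ∑ i, D.eigenvalue i ^ n • D.proj i) D.eq_sum).trans ?_
        rw [Finset.sum_mul_sum]
        refine Finset.sum_congr rfl fun i _ => ?_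
        rw [Finset.sum_eq_single i]
        · rw [smul_mul_smul_comm, D.csoi.idem, pow_succ']
        · intro j _ hj
          rw [smul_mul_smul_comm, D.csoi.orth i j hj.symm, smul_zero]
        · simp
    rw [← C_mul_X_pow_eq_monomial]
    simp [key, mul_smul, smul_comm a]

/-- The functional calculus does not depend on the spectral decomposition. -/
theorem fn_eq_apply {x : V} (D : SpectralDecomposition x) (f : ℝ → ℝ) : fn f x = D.apply f := by
  have h : Nonempty (SpectralDecomposition x) := ⟨D⟩
  rw [fn, dif_pos h]
  classical
  set E := h.some
  set S : Finset ℝ := Finset.univ.image D.eigenvalue ∪ Finset.univ.image E.eigenvalue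
  have hp : ∀ r ∈ S, (Lagrange.interpolate S id f).eval r = f r := fun r hr =>
    Lagrange.eval_interpolate_at_node f (Set.injOn_id _) hr
  have hD := aeval_mulLeft_one D (Lagrange.interpolate S id f)
  have hE := aeval_mulLeft_one E (Lagrange.interpolate S id f)
  have h1 : D.apply f =
      ∑ i, (Lagrange.interpolate S id f).eval (D.eigenvalue i) • D.proj i :=
    Finset.sum_congr rfl fun i _ => by rw [hp _ (by simp [S])]
  have h2 : E.apply f =
      ∑ i, (Lagrange.interpolate S id f).eval (E.eigenvalue i) • E.proj i :=
    Finset.sum_congr rfl fun i _ => by rw [hp _ (by simp [S])]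
  rw [h1, h2, ← hD, ← hE]

/-- If `0` is not an eigenvalue of `σ`, every `ρ` has support contained in that of `σ`. -/
theorem suppLE_of_ne_zero {σ : V} (D : SpectralDecomposition σ) (h : ∀ i, D.eigenvalue i ≠ 0)
    (ρ : V) : SuppLE ρ σ := by
  have : supp σ = 1 := by
    rw [supp, fn_eq_apply D, SpectralDecomposition.apply, ← D.csoi.complete]
    exact Finset.sum_congr rfl fun i _ => by simp [h i]
  rw [SuppLE, this, one_mul]

end Euclidean

end EuclideanJordanAlgebra

/-! The theorem is an Araki–Lieb–Thirring inequality, tr((P_a b)^r) ≤ ⟨b^r, a^(2r)⟩ for r ≥ 1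
(`araki_lieb_thirring`), taken at r = 1 + s, b = ρ, a = σ^(-s/(2(1+s))), followed by monotonicity of
the logarithm.

A Jordan algebra need not act on a Hilbert space, so the inequality comes from complex interpolation
inside the complexification. With X = P_a b put F(z) = ⟨X^((1-z)r), P_{a^(zr)} b^(zr)⟩, the pairing
being complex bilinear so that F is holomorphic. Then F(1/r) = tr X^r =: S, while |F| ≤ S on Re z =
0 and |F| ≤ Q := ⟨b^r, a^(2r)⟩ on Re z = 1. Three lines give S ≤ S^(1-1/r) Q^(1/r), hence S ≤ Q.

Both boundary bounds rest on `norm_cform_quad_le`: |⟨g, P_u v⟩| ≤ tr g for g in the dual cone and u,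
v unitary. The fundamental formula `quad_quad` shows that w = P_u v has its conjugate as inverse,
and `IsPos.quad` keeps P_a g in the cone. -/

namespace EuclideanJordanAlgebra

set_option linter.unusedSectionVars false

/-! ### Jordan identities up to the fundamental formula. -/

section Jordan

variable {V : Type*} [NonAssocCommRing V] [Module ℝ V] [IsCommJordan V]

theorem jordan_linearized (x y z w : V) :
    x * ((y * z) * w) + y * ((z * x) * w) + z * ((x * y) * w) =
      (y * z) * (x * w) + (z * x) * (y * w) + (x * y) * (z * w) := by
  have h := two_nsmul_lie_lmul_lmul_add_add_eq_zero x y z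
  have h2 : 2 • ((x * ((y * z) * w) - (y * z) * (x * w)) + (y * ((z * x) * w) - (z * x) * (y * w)) +
      (z * ((x * y) * w) - (x * y) * (z * w))) = 0 := DFunLike.congr_fun h w
  rw [← ofNat_smul_eq_nsmul ℝ] at h2
  have h3 := (smul_eq_zero.1 h2).resolve_left two_ne_zero
  rw [← sub_eq_zero, ← h3]
  abel

/-- The Jordan triple product. -/
def triple (x y z : V) : V := (x * y) * z + (z * y) * x - (x * z) * y

theorem triple_comm (x y z : V) : triple x y z = triple z y x := by
  rw [triple, triple, mul_comm x z]; abel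

/-- Commutators of multiplications are derivations: exchanging x and w in the linearized identity
leaves its right side unchanged, so the two left sides agree. -/
theorem mul_commutator (x y z w : V) :
    x * (w * (y * z)) - w * (x * (y * z)) =
      y * (x * (w * z) - w * (x * z)) + z * (x * (w * y) - w * (x * y)) := by
  have h1 := jordan_linearized x y z w
  have h2 := jordan_linearized w y z x
  simp only [mul_sub, mul_add]
  simp only [mul_comm] at h1 h2 ⊢
  grind

theorem mul_triple (a u v w : V) :
    a * triple u v w = triple (a * u) v w - triple u (a * v) w + triple u v (a * w) := by
  have h1 := jordan_linearized a u v w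
  have h2 := jordan_linearized a v w u
  have h3 := jordan_linearized a u w v
  simp only [triple, mul_sub, mul_add]
  simp only [mul_comm] at h1 h2 h3 ⊢
  grind

/-- The operator `triple x y` is L_{xy} + [L_x, L_y]. The commutator is a derivation of the triple
product, and L_{xy} obeys the Leibniz rule with a minus sign in the middle slot (`mul_triple`); that
sign turns x, y into y, x there. -/
theorem triple_triple (x y u v w : V) :
    triple x y (triple u v w) =
      triple (triple x y u) v w - triple u (triple y x v) w + triple u v (triple x y w) := by
  have key : ∀ x y z : V, triple x y z = (x * y) * z + (x * (y * z) - y * (x * z)) := by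
    intro x y z
    rw [triple, mul_comm z y, mul_comm (y * z), mul_comm (x * z)]
    abel
  have hder : ∀ p q : V, x * (y * (p * q)) - y * (x * (p * q)) =
      (x * (y * p) - y * (x * p)) * q + p * (x * (y * q) - y * (x * q)) := by
    intro p q
    rw [mul_commutator, mul_comm q]
    abel
  have h1 := mul_triple (x * y) u v w
  have h2 : x * (y * triple u v w) - y * (x * triple u v w) =
      triple (x * (y * u) - y * (x * u)) v w + triple u (x * (y * v) - y * (x * v)) w +
        triple u v (x * (y * w) - y * (x * w)) := by
    simp only [mul_triple, mul_add, mul_sub]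
    simp only [triple, mul_sub, sub_mul, mul_add, add_mul]
    abel
  rw [key x y (triple u v w), h1, h2, key x y u, key y x v, key x y w, mul_comm y x]
  simp only [triple, mul_sub, sub_mul, mul_add, add_mul]
  abel

theorem quad_eq_triple (x y : V) : quad x y = triple x y x := by
  rw [quad, triple, two_smul, mul_comm x (x * y)]

theorem triple_quad (x y v : V) : triple x y (quad x v) = quad x (triple y x v) := by
  simp only [quad_eq_triple]
  have h1 := triple_triple x y x v x
  have h2 := triple_triple x v x y x
  rw [triple_comm x v (triple x y x)] at h1
  rw [triple_comm x y (triple x v x), triple_comm v x y] at h2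
  rw [triple_comm (triple x y x)] at h1
  rw [triple_comm (triple x v x)] at h2
  -- With A and B the two terms and T = `quad x (triple y x v)`, the instances read A = 2B - T and B
  -- = 2A - T, so A = B = T.
  have h3 : (3 : ℝ) • (triple x y (triple x v x) - triple x v (triple x y x)) = 0 := by
    rw [show (3 : ℝ) = 1 + 1 + 1 by norm_num]
    simp only [add_smul, one_smul]
    grind
  have h4 := sub_eq_zero.1 ((smul_eq_zero.1 h3).resolve_left three_ne_zero)
  clear h3
  rw [h4, sub_add_comm, eq_comm] at h1
  rw [h4]
  grind

/-- The fundamental formula `P_{P_x y} = P_x P_y P_x`. -/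
theorem quad_quad (x y z : V) : quad (quad x y) z = quad x (quad y (quad x z)) := by
  -- The choice of `quad x y` as last entry makes `quad (quad x y) z` one of the terms;
  -- `triple_quad` turns the others into values of `quad x`.
  have h1 := triple_triple x y x z (quad x y)
  rw [← quad_eq_triple, ← quad_eq_triple] at h1
  rw [triple_quad x z, triple_quad x y, triple_quad x (triple y x z), triple_quad x y,
    triple_quad x z] at h1
  have h2 := triple_triple z x y x y
  rw [triple_comm y x (triple z x y), ← quad_eq_triple x z, ← quad_eq_triple y (quad x z)] at h2
  have hadd : ∀ a b : V, quad x (a + b) = quad x a + quad x b := by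
    intro a b; simp only [quad_eq_triple, triple, mul_add, add_mul]; abel
  have hsub : ∀ a b : V, quad x (a - b) = quad x a - quad x b := by
    intro a b; simp only [quad_eq_triple, triple, mul_sub, sub_mul]; abel
  have h3 : quad x (quad y (quad x z)) = quad x (triple y x (triple z x y)) +
      quad x (triple (triple z x y) x y) - quad x (triple z x (triple y x y)) := by
    rw [← hadd, ← hsub]
    congr 1
    rw [h2, triple_comm y x]; abel
  rw [h3, triple_comm (triple z x y) x y]
  rw [triple_comm (triple y x z), triple_comm y x z] at h1
  grind

end Jordan

/-! ### Quadratic operators, inverses, and associativity of powers. -/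

section Scalars

variable {V : Type*} [NonAssocCommRing V] [Module ℝ V] [IsScalarTower ℝ V V] [SMulCommClass ℝ V V]

/-- The quadratic representation as a linear map. -/
noncomputable def quadLin (x : V) : Module.End ℝ V :=
  (2 : ℝ) • (LinearMap.mulLeft ℝ x * LinearMap.mulLeft ℝ x) - LinearMap.mulLeft ℝ (x * x)

theorem quadLin_apply (x y : V) : quadLin x y = quad x y := rfl

theorem quadLin_one : quadLin (1 : V) = 1 := by
  ext y
  simp [quadLin_apply, quad, two_smul]

theorem quad_one (x : V) : quad x 1 = x * x := by
  simp [quad, two_smul]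

variable [IsCommJordan V]

theorem quadLin_quad (x y : V) : quadLin (quad x y) = quadLin x * quadLin y * quadLin x := by
  ext z
  exact quad_quad x y z

theorem commute_mulLeft_mulLeft_sq (x : V) :
    Commute (LinearMap.mulLeft ℝ x) (LinearMap.mulLeft ℝ (x * x)) := by
  ext y
  have h := jordan_linearized x x x y
  have h3 : (3 : ℝ) • (x * ((x * x) * y) - (x * x) * (x * y)) = 0 := by
    rw [show (3 : ℝ) = 1 + 1 + 1 by norm_num]
    simp only [add_smul, one_smul]
    rw [← sub_eq_zero] at h
    rw [← h]
    abel
  exact sub_eq_zero.1 ((smul_eq_zero.1 h3).resolve_left three_ne_zero)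

theorem commute_mulLeft_quadLin (x : V) : Commute (LinearMap.mulLeft ℝ x) (quadLin x) :=
  (((Commute.refl _).mul_right (Commute.refl _)).smul_right _).sub_right
    (commute_mulLeft_mulLeft_sq x)

/-- `y` is the inverse of `x`, phrased by the quadratic representation. -/
def IsInv (x y : V) : Prop := quad x y = x ∧ quad x (y * y) = 1

/-- By the fundamental formula P_x P_{y²} P_x = P_1 = 1, so P_x is invertible and cancels from P_x
P_y P_x = P_x. -/
theorem IsInv.quadLin_mul {x y : V} (h : IsInv x y) :
    quadLin x * quadLin y = 1 ∧ quadLin y * quadLin x = 1 := by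
  have h1 : quadLin x * (quadLin (y * y) * quadLin x) = 1 := by
    rw [← mul_assoc, ← quadLin_quad, h.2, quadLin_one]
  have h2 : (quadLin x * quadLin (y * y)) * quadLin x = 1 := by rw [mul_assoc, h1]
  have h3 : quadLin x * quadLin y * quadLin x = quadLin x := by rw [← quadLin_quad, h.1]
  constructor
  · calc quadLin x * quadLin y = quadLin x * quadLin y * (quadLin x * (quadLin (y * y) * quadLin x)) := by
          rw [h1, mul_one]
      _ = 1 := by rw [← mul_assoc, h3, h1]
  · calc quadLin y * quadLin x = ((quadLin x * quadLin (y * y)) * quadLin x) * (quadLin y * quadLin x) := by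
          rw [h2, one_mul]
      _ = (quadLin x * quadLin (y * y)) * (quadLin x * quadLin y * quadLin x) := by
          simp only [mul_assoc]
      _ = 1 := by rw [h3, h2]

/-- Let w = P_u v and w' = P_{u'} v'. Then P_w w' = w, and P_w commutes with multiplication by w, so
P_w(w w') = w² = P_w 1; the invertible P_w cancels. -/
theorem IsInv.mul_quad_quad {u u' v v' : V} (hu : IsInv u u') (hv : IsInv v v') :
    quad u v * quad u' v' = 1 := by
  set w := quad u v with hw
  have hPw : quadLin w = quadLin u * quadLin v * quadLin u := quadLin_quad u v
  have h1 : quadLin w * (quadLin u' * quadLin v' * quadLin u') = 1 := by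
    rw [hPw]
    calc _ = quadLin u * (quadLin v * ((quadLin u * quadLin u') * quadLin v')) * quadLin u' := by
          simp only [mul_assoc]
      _ = 1 := by rw [hu.quadLin_mul.1, one_mul, hv.quadLin_mul.1, mul_one, hu.quadLin_mul.1]
  have h1' : (quadLin u' * quadLin v' * quadLin u') * quadLin w = 1 := by
    rw [hPw]
    calc _ = quadLin u' * (quadLin v' * ((quadLin u' * quadLin u) * quadLin v)) * quadLin u := by
          simp only [mul_assoc]
      _ = 1 := by rw [hu.quadLin_mul.2, one_mul, hv.quadLin_mul.2, mul_one, hu.quadLin_mul.2]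
  have h2 : quadLin w (quad u' v') = w := by
    rw [hPw, hw]
    change quadLin u (quadLin v ((quadLin u * quadLin u') v')) = quadLin u v
    rw [hu.quadLin_mul.1]
    exact congrArg _ hv.1
  have h3 : quadLin w (w * quad u' v') = w * w := by
    have h4 := LinearMap.congr_fun (commute_mulLeft_quadLin w).eq (quad u' v')
    simp only [Module.End.mul_apply, LinearMap.mulLeft_apply] at h4
    rw [← h4, h2]
  calc w * quad u' v' = (quadLin u' * quadLin v' * quadLin u' * quadLin w) (w * quad u' v') := by
        rw [h1']; rfl
    _ = (quadLin u' * quadLin v' * quadLin u') (quadLin w 1) := by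
        rw [Module.End.mul_apply, h3, quadLin_apply, quad_one]
    _ = (quadLin u' * quadLin v' * quadLin u' * quadLin w) 1 := rfl
    _ = 1 := by rw [h1']; rfl

/-- With y = xⁿ this is a recursion for multiplication by powers of x, which drives the two-step
induction in `commute_mulLeft_pow`. -/
theorem mulLeft_mul_mul (x y : V) :
    LinearMap.mulLeft ℝ (x * (x * y)) =
      LinearMap.mulLeft ℝ (x * x) * LinearMap.mulLeft ℝ y +
        (2 : ℝ) • (LinearMap.mulLeft ℝ (x * y) * LinearMap.mulLeft ℝ x) -
        LinearMap.mulLeft ℝ x * LinearMap.mulLeft ℝ x * LinearMap.mulLeft ℝ y -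
        LinearMap.mulLeft ℝ y * LinearMap.mulLeft ℝ x * LinearMap.mulLeft ℝ x := by
  ext v
  have h := jordan_linearized x y v x
  simp only [two_smul, LinearMap.sub_apply, LinearMap.add_apply, Module.End.mul_apply,
    LinearMap.mulLeft_apply]
  simp only [mul_comm] at h ⊢
  grind

theorem commute_mulLeft_pow (x : V) (n : ℕ) :
    Commute (LinearMap.mulLeft ℝ x) (LinearMap.mulLeft ℝ ((LinearMap.mulLeft ℝ x ^ n) 1)) := by
  induction n using Nat.twoStepInduction with
  | zero =>
    rw [pow_zero, Module.End.one_apply, LinearMap.mulLeft_one]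
    exact Commute.one_right _
  | one => simp
  | more n h0 h1 =>
    rw [pow_succ', pow_succ'] at *
    simp only [Module.End.mul_apply, LinearMap.mulLeft_apply] at *
    rw [mulLeft_mul_mul]
    have hx := Commute.refl (LinearMap.mulLeft ℝ x)
    exact ((((commute_mulLeft_mulLeft_sq x).mul_right h0).add_right
      ((h1.mul_right hx).smul_right _)).sub_right ((hx.mul_right hx).mul_right h0)).sub_right
      ((h0.mul_right hx).mul_right hx)

open Polynomial in
-- Multiplication by p(x) commutes with L_x, hence with q(L_x); evaluating at 1 gives power
-- associativity.
theorem aeval_mulLeft_mul (x : V) (p q : ℝ[X]) :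
    aeval (LinearMap.mulLeft ℝ x) p 1 * aeval (LinearMap.mulLeft ℝ x) q 1 =
      aeval (LinearMap.mulLeft ℝ x) (p * q) 1 := by
  have h : Commute (LinearMap.mulLeft ℝ x)
      (LinearMap.mulLeft ℝ (aeval (LinearMap.mulLeft ℝ x) p 1)) := by
    induction p using Polynomial.induction_on' with
    | add p q hp hq =>
      have : LinearMap.mulLeft ℝ (aeval (LinearMap.mulLeft ℝ x) (p + q) 1) =
          LinearMap.mulLeft ℝ (aeval (LinearMap.mulLeft ℝ x) p 1) +
            LinearMap.mulLeft ℝ (aeval (LinearMap.mulLeft ℝ x) q 1) := by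
        ext; simp [add_mul]
      rw [this]
      exact hp.add_right hq
    | monomial n a =>
      have : LinearMap.mulLeft ℝ (aeval (LinearMap.mulLeft ℝ x) (monomial n a) 1) =
          a • LinearMap.mulLeft ℝ ((LinearMap.mulLeft ℝ x ^ n) 1) := by
        ext
        rw [← C_mul_X_pow_eq_monomial]
        simp [smul_mul_assoc]
      rw [this]
      exact (commute_mulLeft_pow x n).smul_right a
  have h2 : Commute (aeval (LinearMap.mulLeft ℝ x) q)
      (LinearMap.mulLeft ℝ (aeval (LinearMap.mulLeft ℝ x) p 1)) := by
    induction q using Polynomial.induction_on' with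
    | add p q hp hq => rw [map_add]; exact hp.add_left hq
    | monomial n a =>
      rw [← C_mul_X_pow_eq_monomial, map_mul, aeval_C, map_pow, aeval_X,
        Algebra.algebraMap_eq_smul_one, smul_one_mul]
      exact (h.pow_left n).smul_left a
  have h3 := LinearMap.congr_fun h2.eq 1
  simp only [Module.End.mul_apply, LinearMap.mulLeft_apply, mul_one] at h3
  rw [← h3, mul_comm p q, map_mul, Module.End.mul_apply]

/-- The Peirce polynomial of an idempotent. -/
theorem peirce_identity {e : V} (he : e * e = e) (w : V) :
    (2 : ℝ) • (e * (e * (e * w))) - (3 : ℝ) • (e * (e * w)) + e * w = 0 := by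
  have h := jordan_linearized e w e e
  rw [show (3 : ℝ) = 1 + 1 + 1 by norm_num, two_smul, add_smul, add_smul, one_smul]
  simp only [he, mul_comm w e, mul_comm (e * w) e] at h
  grind

end Scalars


/-! ### Calculus on a fixed system of orthogonal idempotents, with real or complex coefficients. -/

section Diagonal

variable {𝕜 W ι : Type*} [Field 𝕜] [NonAssocCommRing W] [Module 𝕜 W] [Fintype ι]

/-- The combination `∑ i, z i • c i` of a family of idempotents. -/
def diag (c : ι → W) (z : ι → 𝕜) : W := ∑ i, z i • c i

variable [IsScalarTower 𝕜 W W] [SMulCommClass 𝕜 W W] {c : ι → W}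

theorem diag_mul_diag (hc : IsCSOI c) (z w : ι → 𝕜) :
    diag c z * diag c w = diag c (fun i => z i * w i) := by
  rw [diag, diag, Finset.sum_mul_sum]
  refine Finset.sum_congr rfl fun i _ => ?_
  rw [Finset.sum_eq_single i]
  · rw [smul_mul_smul_comm, hc.idem]
  · intro j _ hj
    rw [smul_mul_smul_comm, hc.orth i j hj.symm, smul_zero]
  · simp

theorem diag_one (hc : IsCSOI c) : diag c (fun _ => (1 : 𝕜)) = 1 := by
  simp [diag, hc.complete]

theorem diag_mul_proj (hc : IsCSOI c) (z : ι → 𝕜) (i : ι) : diag c z * c i = z i • c i := by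
  rw [diag, Finset.sum_mul, Finset.sum_eq_single i]
  · rw [smul_mul_assoc, hc.idem]
  · intro j _ hj
    rw [smul_mul_assoc, hc.orth j i hj, smul_zero]
  · simp

variable [Module ℝ W]

theorem quad_diag_diag (hc : IsCSOI c) (z w : ι → 𝕜) :
    quad (diag c z) (diag c w) = diag c (fun i => z i * z i * w i) := by
  rw [quad, diag_mul_diag hc, diag_mul_diag hc, diag_mul_diag hc, diag_mul_diag hc, two_smul]
  simp only [mul_assoc, add_sub_cancel_right]

theorem isInv_diag (hc : IsCSOI c) {z : ι → 𝕜} (hz : ∀ i, z i ≠ 0) :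
    IsInv (diag c z) (diag c fun i => (z i)⁻¹) := by
  constructor
  · rw [quad_diag_diag hc]
    simp [hz]
  · rw [diag_mul_diag hc, quad_diag_diag hc, ← diag_one (𝕜 := 𝕜) hc]
    congr 1
    ext i
    field_simp [hz i]

variable [IsScalarTower ℝ W W] [SMulCommClass ℝ W W] [IsCommJordan W]

theorem diag_mul_left_comm (hc : IsCSOI c) (z w : ι → 𝕜) (y : W) :
    diag c z * (diag c w * y) = diag c w * (diag c z * y) := by
  have h : ∀ i j, c i * (c j * y) = c j * (c i * y) := by
    intro i j
    by_cases hij : i = j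
    · rw [hij]
    -- Every term containing the product of the two orthogonal idempotents drops out, leaving
    -- exactly their commutation.
    have h0 := jordan_linearized (c i) (c j) (c j) y
    simp only [hc.idem, hc.orth i j hij, hc.orth j i (Ne.symm hij), zero_mul, mul_zero,
      add_zero] at h0
    exact h0
  simp only [diag, Finset.sum_mul, Finset.mul_sum, smul_mul_assoc, mul_smul_comm,
    Finset.smul_sum]
  rw [Finset.sum_comm]
  refine Finset.sum_congr rfl fun i _ => Finset.sum_congr rfl fun j _ => ?_
  rw [h, smul_comm]

theorem quad_diag_comm (hc : IsCSOI c) (z w : ι → 𝕜) (y : W) :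
    quad (diag c z) (quad (diag c w) y) = quad (diag c w) (quad (diag c z) y) := by
  have h : ∀ z w : ι → 𝕜, Commute (LinearMap.mulLeft ℝ (diag c z)) (LinearMap.mulLeft ℝ (diag c w)) := by
    intro z w
    ext y
    exact diag_mul_left_comm hc z w y
  have h2 : ∀ z w : ι → 𝕜, Commute (LinearMap.mulLeft ℝ (diag c z)) (quadLin (diag c w)) := by
    intro z w
    rw [quadLin, diag_mul_diag hc]
    exact (((h z w).mul_right (h z w)).smul_right _).sub_right (h z _)
  have h3 : Commute (quadLin (diag c z)) (quadLin (diag c w)) := by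
    rw [quadLin, diag_mul_diag hc]
    exact (((h2 z w).mul_left (h2 z w)).smul_left _).sub_left (h2 _ w)
  exact LinearMap.congr_fun h3.eq y

/-- The factor is a square because the fundamental formula produces P_a P_b P_a, whose outer factors
are merged by commutativity. -/
theorem quad_diag_mul (hc : IsCSOI c) (z w : ι → 𝕜) (y : W) :
    quad (diag c fun i => z i * z i * w i) y =
      quad (diag c fun i => z i * z i) (quad (diag c w) y) := by
  have h1 : diag c (fun i => z i * z i) = quad (diag c z) 1 := by
    rw [quad_one, diag_mul_diag hc]
  rw [← quad_diag_diag hc, h1]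
  simp only [quad_quad]
  rw [quad_diag_comm hc w z]
  congr 1
  exact (LinearMap.congr_fun (quadLin_one (V := W)) _).symm

end Diagonal

/-! ### The spectral theorem. -/

section Spectral

variable {V : Type*} [NonAssocCommRing V] [Module ℝ V] [EuclideanJordanAlgebra V]

theorem form_nonneg (x : V) : 0 ≤ form x x := by
  by_cases h : x = 0
  · simp [h]
  · exact (form_pos x h).le

theorem form_mul_left_comm (x y z : V) : form (x * y) z = form y (x * z) := by
  rw [mul_comm, form_assoc]

open Polynomial in
-- Associativity of the form makes L_x symmetric, hence diagonalizable over ℝ; the finite set is its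
-- spectrum.
theorem exists_annihilating_finset (x : V) : ∃ S : Finset ℝ, ∀ p : ℝ[X],
    (∀ r ∈ S, p.eval r = 0) → aeval (LinearMap.mulLeft ℝ x) p = 0 := by
  classical
  let core : InnerProductSpace.Core ℝ V :=
    { inner := fun x y => form x y
      conj_inner_symm := fun x y => form_symm y x
      re_inner_nonneg := fun x => form_nonneg x
      add_left := fun x y z => by simp
      smul_left := fun x y r => by simp
      definite := fun x hx => by
        by_contra h
        exact (form_pos x h).ne' hx }
  let _ : NormedAddCommGroup V := core.toNormedAddCommGroup
  let _ : InnerProductSpace ℝ V := InnerProductSpace.ofCore core.toCore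
  have hsymm : (LinearMap.mulLeft ℝ x).IsSymmetric := fun y z => form_mul_left_comm x y z
  refine ⟨Finset.univ.image (hsymm.eigenvalues rfl), fun p hp => ?_⟩
  refine (hsymm.eigenvectorBasis rfl).toBasis.ext fun i => ?_
  rw [OrthonormalBasis.coe_toBasis]
  have h := Module.End.aeval_apply_of_hasEigenvector (p := p)
    (hsymm.hasEigenvector_eigenvectorBasis rfl i)
  rw [h, hp _ (by simp)]
  simp

open Polynomial in
/-- The spectral theorem. -/
theorem nonempty_spectralDecomposition (x : V) : Nonempty (SpectralDecomposition x) := by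
  classical
  obtain ⟨S, hS⟩ := exists_annihilating_finset x
  set L := LinearMap.mulLeft ℝ x
  let q : ℝ → ℝ[X] := Lagrange.basis S id
  let v : ℝ → V := fun r => aeval L (q r) 1
  have hext : ∀ p p' : ℝ[X], (∀ r ∈ S, p.eval r = p'.eval r) → aeval L p = aeval L p' := by
    intro p p' h
    rw [← sub_eq_zero, ← map_sub]
    exact hS _ fun r hr => by simp [h r hr]
  have hq : ∀ r ∈ S, ∀ t ∈ S, (q r).eval t = if r = t then 1 else 0 := by
    intro r hr t ht
    split_ifs with h
    · subst h
      exact Lagrange.eval_basis_self (v := id) (Set.injOn_id _) hr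
    · exact Lagrange.eval_basis_of_ne (v := id) h ht
  have hmul : ∀ r ∈ S, ∀ t ∈ S, v r * v t = if r = t then v r else 0 := by
    intro r hr t ht
    have h1 : v r * v t = aeval L (q r * q t) 1 := aeval_mulLeft_mul x _ _
    rw [h1]
    split_ifs with h
    · subst h
      rw [hext (q r * q r) (q r)]
      intro t ht
      rw [eval_mul, hq r hr t ht]
      split_ifs <;> simp
    · rw [hS (q r * q t), LinearMap.zero_apply]
      intro a ha
      rw [eval_mul, hq r hr a ha, hq t ht a ha]
      split_ifs with h1 h2
      · exact absurd (h1.trans h2.symm) h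
      all_goals simp
  have hsum : ∑ r ∈ S, v r = 1 := by
    have h1 : aeval L (∑ r ∈ S, q r) = aeval L (1 : ℝ[X]) := by
      apply hext
      intro t ht
      rw [eval_finsetSum, Finset.sum_congr rfl fun r hr => hq r hr t ht]
      simp [ht]
    have h2 := LinearMap.congr_fun h1 1
    simpa [v] using h2
  have hx : x = ∑ r ∈ S, r • v r := by
    have h1 : aeval L (∑ r ∈ S, C r * q r) = aeval L (X : ℝ[X]) := by
      apply hext
      intro t ht
      rw [eval_finsetSum, Finset.sum_congr rfl fun r hr =>
        show (C r * q r).eval t = r * if r = t then 1 else 0 by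
          rw [eval_mul, hq r hr t ht, eval_C]]
      simp [ht]
    have h2 := LinearMap.congr_fun h1 1
    simpa [v, L] using h2.symm
  -- L_x may have eigenvalues that are not spectral values of x, such as means of two of them; their
  -- Lagrange idempotents are zero and are discarded.
  let T := S.filter fun r => v r ≠ 0
  have hT : ∀ i : Fin T.card, (T.equivFin.symm i : ℝ) ∈ S := fun i =>
    (Finset.mem_filter.1 (T.equivFin.symm i).2).1
  have hTS : ∀ f : ℝ → V, (∀ r, v r = 0 → f r = 0) →
      ∑ i : Fin T.card, f (T.equivFin.symm i) = ∑ r ∈ S, f r := by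
    intro f hf
    rw [T.equivFin.symm.sum_comp fun r : T => f r, Finset.sum_coe_sort T f,
      Finset.sum_filter_of_ne]
    intro r _ h h0
    exact h (hf r h0)
  have hinj : Function.Injective fun i : Fin T.card => (T.equivFin.symm i : ℝ) :=
    Subtype.val_injective.comp T.equivFin.symm.injective
  refine ⟨⟨T.card, fun i => (T.equivFin.symm i : ℝ), fun i => v (T.equivFin.symm i), hinj,
    ⟨fun i => ?_, fun i => (Finset.mem_filter.1 (T.equivFin.symm i).2).2, fun i j hij => ?_, ?_⟩, ?_⟩⟩
  · rw [hmul _ (hT i) _ (hT i), if_pos rfl]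
  · rw [hmul _ (hT i) _ (hT j), if_neg fun h => hij (hinj h)]
  · rw [hTS v fun r h => h, hsum]
  · rw [hTS (fun r => r • v r) fun r h => by simp [h], ← hx]

end Spectral

/-! ### Positivity and the dual cone. -/

section Cone

variable {V : Type*} [NonAssocCommRing V] [Module ℝ V] [EuclideanJordanAlgebra V]

theorem SpectralDecomposition.eq_diag {x : V} (D : SpectralDecomposition x) :
    x = diag D.proj D.eigenvalue := D.eq_sum

/-- Membership in the dual of the cone of squares. -/
def IsPos (g : V) : Prop := ∀ y : V, 0 ≤ form g (y * y)

/-- Multiplication by e has Peirce eigenvalues among 0, 1/2, 1, so it is positive semidefinite; a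
sum of squares replaces the eigenspaces. -/
theorem isPos_of_idem {e : V} (he : e * e = e) : IsPos e := by
  intro y
  rw [← form_assoc]
  -- `L = 8 (L - L²)² + (2L² - L)²` for `L` the multiplication by `e`
  have h1 := peirce_identity he y
  have hs : ∀ a b : V, form (e * a) b = form a (e * b) := form_mul_left_comm e
  have h2 : e * (e * (e * y)) = (3 / 2 : ℝ) • (e * (e * y)) - (1 / 2 : ℝ) • (e * y) := by
    have h4 : e * (e * (e * y)) - ((3 / 2 : ℝ) • (e * (e * y)) - (1 / 2 : ℝ) • (e * y)) = (1 / 2 : ℝ) •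
        ((2 : ℝ) • (e * (e * (e * y))) - (3 : ℝ) • (e * (e * y)) + e * y) := by module
    rw [h1, smul_zero] at h4
    exact sub_eq_zero.1 h4
  have h3 : e * (e * (e * (e * y))) =
      (3 / 2 : ℝ) • (e * (e * (e * y))) - (1 / 2 : ℝ) • (e * (e * y)) := by
    conv_lhs => rw [h2]
    simp only [mul_smul_comm, mul_sub]
  have f2 := congrArg (form y) h2
  have f3 := congrArg (form y) h3
  have key : form (e * y) y = 8 * form (e * y - e * (e * y)) (e * y - e * (e * y)) +
      form ((2 : ℝ) • (e * (e * y)) - e * y) ((2 : ℝ) • (e * (e * y)) - e * y) := by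
    simp only [map_sub, map_smul, LinearMap.sub_apply, LinearMap.smul_apply, smul_eq_mul, hs] at *
    linarith
  rw [key]
  have := form_nonneg (e * y - e * (e * y))
  have := form_nonneg ((2 : ℝ) • (e * (e * y)) - e * y)
  positivity

theorem IsPos.form_idem_nonneg {g e : V} (hg : IsPos g) (he : e * e = e) : 0 ≤ form g e := by
  rw [← he]
  exact hg e

theorem isPos_diag {ι : Type*} [Fintype ι] {c : ι → V} (hc : IsCSOI c) {z : ι → ℝ}
    (hz : ∀ i, 0 ≤ z i) : IsPos (diag c z) := by
  intro y
  simp only [diag, map_sum, map_smul, LinearMap.sum_apply, LinearMap.smul_apply, smul_eq_mul]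
  exact Finset.sum_nonneg fun i _ => mul_nonneg (hz i) (isPos_of_idem (hc.idem i) y)

theorem IsCSOI.form_self_pos {ι : Type*} [Fintype ι] {c : ι → V} (hc : IsCSOI c) (i : ι) :
    0 < form (c i) (c i) := form_pos _ (hc.ne_zero i)

theorem IsCSOI.tr_proj {ι : Type*} [Fintype ι] {c : ι → V} (hc : IsCSOI c) (i : ι) :
    tr (c i) = form (c i) (c i) := by
  rw [tr, ← hc.idem i, form_assoc, mul_one, hc.idem i]

theorem SpectralDecomposition.form_proj {x : V} (D : SpectralDecomposition x) (i : Fin D.d) :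
    form x (D.proj i) = D.eigenvalue i * form (D.proj i) (D.proj i) := by
  conv_lhs => rw [← D.csoi.idem i, ← form_assoc]; arg 1; arg 2; arg 1; rw [D.eq_diag]
  rw [diag_mul_proj D.csoi]
  simp

theorem SpectralDecomposition.eigenvalue_nonneg {x : V} (D : SpectralDecomposition x) (hx : IsPos x)
    (i : Fin D.d) : 0 ≤ D.eigenvalue i := by
  have h := hx.form_idem_nonneg (D.csoi.idem i)
  rw [D.form_proj] at h
  exact nonneg_of_mul_nonneg_left h (D.csoi.form_self_pos i)

theorem isPos_sq (x : V) : IsPos (x * x) := by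
  obtain ⟨D⟩ := nonempty_spectralDecomposition x
  rw [D.eq_diag, diag_mul_diag D.csoi]
  exact isPos_diag D.csoi fun i => mul_self_nonneg _

theorem form_quad (x y z : V) : form (quad x y) z = form y (quad x z) := by
  simp only [quad, map_sub, map_smul, LinearMap.sub_apply, LinearMap.smul_apply, form_mul_left_comm]

/-- Suppose P_a g has an eigenvalue -m < 0 with idempotent e. Then g' = g + m a⁻² has P_a g' = P_a g
+ m·1, whose quadratic operator kills e. But g' is strictly positive, hence invertible, so P_a
P_{g'} P_a is injective: a contradiction. -/
theorem IsPos.quad {ι : Type*} [Fintype ι] {c : ι → V} (hc : IsCSOI c) {z : ι → ℝ}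
    (hz : ∀ i, z i ≠ 0) {g : V} (hg : IsPos g) : IsPos (quad (diag c z) g) := by
  set a := diag c z with ha
  set a' := diag c fun i => (z i)⁻¹ with ha'
  have hinv : IsInv a a' := isInv_diag hc hz
  obtain ⟨D⟩ := nonempty_spectralDecomposition (EuclideanJordanAlgebra.quad a g)
  suffices h : ∀ i, 0 ≤ D.eigenvalue i by
    rw [D.eq_diag]
    exact isPos_diag D.csoi h
  intro i
  by_contra! hneg
  set m := - D.eigenvalue i with hm
  have hm0 : 0 < m := by linarith
  set g' := g + m • (a' * a') with hg'
  have h1 : EuclideanJordanAlgebra.quad a g' = diag D.proj fun j => D.eigenvalue j + m := by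
    have h2 : EuclideanJordanAlgebra.quad a g' = EuclideanJordanAlgebra.quad a g + m • 1 := by
      rw [← hinv.2]
      simp only [← quadLin_apply, hg', map_add, map_smul]
    refine (h2.trans (congrArg (· + m • (1 : V)) D.eq_diag)).trans ?_
    rw [← diag_one (𝕜 := ℝ) D.csoi]
    simp [diag, add_smul, Finset.sum_add_distrib, Finset.smul_sum]
  obtain ⟨E⟩ := nonempty_spectralDecomposition g'
  have hE : ∀ j, E.eigenvalue j ≠ 0 := by
    intro j
    have hj := E.form_proj j
    have h2 : form g' (E.proj j) = form g (E.proj j) + m * form (a' * a') (E.proj j) := by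
      simp [hg']
    have h3 := hg.form_idem_nonneg (E.csoi.idem j)
    have h4 : 0 < form (a' * a') (E.proj j) := by
      rw [ha', diag_mul_diag hc]
      simp only [diag, map_sum, map_smul, LinearMap.sum_apply, LinearMap.smul_apply, smul_eq_mul]
      have hnn : ∀ k, 0 ≤ form (c k) (E.proj j) := fun k =>
        (isPos_of_idem (hc.idem k)).form_idem_nonneg (E.csoi.idem j)
      have hz2 : ∀ k, 0 < (z k)⁻¹ * (z k)⁻¹ := fun k => mul_self_pos.2 (inv_ne_zero (hz k))
      refine Finset.sum_pos' (fun k _ => mul_nonneg (hz2 k).le (hnn k)) ?_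
      -- The c k sum to 1, so if no term were positive the trace of the non-zero idempotent `E.proj
      -- j` would be at most 0.
      by_contra! hall
      have h5 : ∑ k, form (c k) (E.proj j) ≤ 0 := Finset.sum_nonpos fun k hk =>
        nonpos_of_mul_nonpos_right (hall k hk) (hz2 k)
      rw [← LinearMap.sum_apply, ← map_sum, hc.complete, form_symm] at h5
      have h6 := E.csoi.form_self_pos j
      rw [← E.csoi.tr_proj, tr] at h6
      linarith
    intro h0
    rw [h0, zero_mul, h2] at hj
    have := mul_pos hm0 h4
    linarith
  have hgi : IsInv g' (diag E.proj fun j => (E.eigenvalue j)⁻¹) := by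
    have := isInv_diag E.csoi hE
    rwa [← E.eq_diag] at this
  have h0 : quadLin (EuclideanJordanAlgebra.quad a g') (D.proj i) = 0 := by
    have h5 : D.proj i = diag D.proj (Pi.single i (1 : ℝ)) := by
      simp [diag, Pi.single_apply]
    rw [h1, h5, quadLin_apply, quad_diag_diag D.csoi]
    refine Finset.sum_eq_zero fun j _ => ?_
    by_cases hji : j = i
    · subst hji; simp [hm]
    · simp [hji]
  rw [quadLin_quad] at h0
  have hcancel : ∀ {x y : V}, IsInv x y → ∀ w, quadLin x w = 0 → w = 0 := by
    intro x y hxy w hw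
    have := LinearMap.congr_fun hxy.quadLin_mul.2 w
    rw [Module.End.mul_apply, hw, map_zero] at this
    exact this.symm
  exact D.csoi.ne_zero i (hcancel hinv _ (hcancel hgi _ (hcancel hinv _ h0)))

end Cone

/-! ### The complexification and the trace bound for unitary elements. -/

section Complexification

/-- The complexification of `V`; the pair `(x, y)` stands for `x + i y`. -/
def Cx (V : Type*) := V × V

namespace Cx

variable {V : Type*} [NonAssocCommRing V] [Module ℝ V]

/-- The real part. -/
def re (x : Cx V) : V := x.1

/-- The imaginary part. -/
def im (x : Cx V) : V := x.2

/-- The element with given real and imaginary parts. -/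
def mk (a b : V) : Cx V := (a, b)

@[ext]
theorem ext {x y : Cx V} (h1 : x.re = y.re) (h2 : x.im = y.im) : x = y := Prod.ext h1 h2

instance : AddCommGroup (Cx V) := inferInstanceAs (AddCommGroup (V × V))

instance : Mul (Cx V) := ⟨fun x y => mk (x.re * y.re - x.im * y.im) (x.re * y.im + x.im * y.re)⟩

instance : One (Cx V) := ⟨mk 1 0⟩

instance : SMul ℂ (Cx V) :=
  ⟨fun z x => mk (z.re • x.re - z.im • x.im) (z.re • x.im + z.im • x.re)⟩

@[simp] theorem re_mk (a b : V) : (mk a b).re = a := rfl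
@[simp] theorem im_mk (a b : V) : (mk a b).im = b := rfl
@[simp] theorem re_zero : (0 : Cx V).re = 0 := rfl
@[simp] theorem im_zero : (0 : Cx V).im = 0 := rfl
@[simp] theorem re_add (x y : Cx V) : (x + y).re = x.re + y.re := rfl
@[simp] theorem im_add (x y : Cx V) : (x + y).im = x.im + y.im := rfl
@[simp] theorem re_sub (x y : Cx V) : (x - y).re = x.re - y.re := rfl
@[simp] theorem im_sub (x y : Cx V) : (x - y).im = x.im - y.im := rfl
@[simp] theorem re_one : (1 : Cx V).re = 1 := rfl
@[simp] theorem im_one : (1 : Cx V).im = 0 := rfl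
@[simp] theorem re_mul (x y : Cx V) : (x * y).re = x.re * y.re - x.im * y.im := rfl
@[simp] theorem im_mul (x y : Cx V) : (x * y).im = x.re * y.im + x.im * y.re := rfl
@[simp] theorem re_smul (z : ℂ) (x : Cx V) : (z • x).re = z.re • x.re - z.im • x.im := rfl
@[simp] theorem im_smul (z : ℂ) (x : Cx V) : (z • x).im = z.re • x.im + z.im • x.re := rfl

instance : NonAssocCommRing (Cx V) :=
  { (inferInstance : AddCommGroup (Cx V)) with
    mul := (· * ·)
    one := 1
    left_distrib := fun x y z => by ext <;> simp [mul_add] <;> abel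
    right_distrib := fun x y z => by ext <;> simp [add_mul] <;> abel
    zero_mul := fun x => by ext <;> simp
    mul_zero := fun x => by ext <;> simp
    one_mul := fun x => by ext <;> simp
    mul_one := fun x => by ext <;> simp
    mul_comm := fun x y => by
      ext
      · simp only [re_mul, mul_comm]
      · simp only [im_mul, mul_comm x.re, mul_comm x.im, add_comm] }

instance : Module ℂ (Cx V) where
  one_smul x := by ext <;> simp
  mul_smul z w x := by ext <;> simp <;> module
  smul_zero z := by ext <;> simp
  smul_add z x y := by ext <;> simp <;> module
  add_smul z w x := by ext <;> simp <;> module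
  zero_smul x := by ext <;> simp

/-- The complex conjugation. -/
def conj (x : Cx V) : Cx V := mk x.re (-x.im)

@[simp] theorem re_conj (x : Cx V) : x.conj.re = x.re := rfl
@[simp] theorem im_conj (x : Cx V) : x.conj.im = -x.im := rfl

theorem conj_add (x y : Cx V) : (x + y).conj = x.conj + y.conj := by
  ext <;> simp [add_comm]

theorem conj_sub (x y : Cx V) : (x - y).conj = x.conj - y.conj := by
  ext <;> simp; abel

theorem conj_mul (x y : Cx V) : (x * y).conj = x.conj * y.conj := by
  ext <;> simp; abel

theorem conj_smul (z : ℂ) (x : Cx V) : (z • x).conj = (starRingEnd ℂ z) • x.conj := by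
  ext <;> simp; abel

theorem conj_quad (x y : Cx V) : (quad x y).conj = quad x.conj y.conj := by
  simp only [quad, two_smul, conj_sub, conj_add, conj_mul]

/-- The inclusion of `V` in its complexification. -/
def ofReal (x : V) : Cx V := mk x 0

@[simp] theorem re_ofReal (x : V) : (ofReal x).re = x := rfl
@[simp] theorem im_ofReal (x : V) : (ofReal x).im = 0 := rfl

theorem ofReal_mul (x y : V) : ofReal (x * y) = ofReal x * ofReal y := by
  ext <;> simp

theorem ofReal_quad (x y : V) : ofReal (quad x y) = quad (ofReal x) (ofReal y) := by
  ext <;> simp [quad, two_smul]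

/-- The inclusion of `V` as an additive map. -/
def ofRealHom : V →+ Cx V where
  toFun := ofReal
  map_zero' := rfl
  map_add' x y := by ext <;> simp

theorem ofReal_diag {ι : Type*} [Fintype ι] (c : ι → V) (z : ι → ℝ) :
    ofReal (diag c z) = diag (fun i => ofReal (c i)) (fun i => (z i : ℂ)) := by
  change ofRealHom (diag c z) = _
  rw [diag, map_sum]
  refine Finset.sum_congr rfl fun i _ => ?_
  change ofReal (z i • c i) = (z i : ℂ) • ofReal (c i)
  ext
  · rw [re_smul]; simp
  · rw [im_smul]; simp

/-- The conjugation as an additive map. -/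
def conjHom : Cx V →+ Cx V where
  toFun := conj
  map_zero' := by ext <;> simp
  map_add' := conj_add

theorem conj_diag {ι : Type*} [Fintype ι] (c : ι → V) (z : ι → ℂ) :
    (diag (fun i => ofReal (c i)) z).conj =
      diag (fun i => ofReal (c i)) (fun i => starRingEnd ℂ (z i)) := by
  change conjHom _ = _
  rw [diag, map_sum]
  refine Finset.sum_congr rfl fun i _ => ?_
  change conj _ = _
  rw [conj_smul]
  congr 1
  ext <;> simp

theorem isCSOI {ι : Type*} [Fintype ι] {c : ι → V} (hc : IsCSOI c) :
    IsCSOI fun i => ofReal (c i) where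
  idem i := by rw [← ofReal_mul, hc.idem]
  ne_zero i h := hc.ne_zero i (congrArg re h)
  orth i j hij := by rw [← ofReal_mul, hc.orth i j hij]; rfl
  complete := by
    have := congrArg ofRealHom hc.complete
    rwa [map_sum] at this

section Scalars

variable [IsScalarTower ℝ V V] [SMulCommClass ℝ V V]

instance : IsScalarTower ℂ (Cx V) (Cx V) where
  smul_assoc z x y := by
    ext <;> simp [smul_mul_assoc, sub_mul, add_mul] <;> module

instance : SMulCommClass ℂ (Cx V) (Cx V) where
  smul_comm z x y := by
    ext <;> simp [mul_smul_comm, mul_sub, mul_add] <;> module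

instance : IsScalarTower ℝ (Cx V) (Cx V) where
  smul_assoc r x y := smul_assoc (r : ℂ) x y

instance : SMulCommClass ℝ (Cx V) (Cx V) where
  smul_comm r x y := smul_comm (r : ℂ) x y

instance [IsCommJordan V] : IsCommJordan (Cx V) where
  lmul_comm_rmul_rmul x y := by
    have key : ∀ v : V, x.re * ((x.re * x.re) * v) = (x.re * x.re) * (x.re * v) := fun v =>
      LinearMap.congr_fun (commute_mulLeft_mulLeft_sq x.re).eq v
    have key2 : ∀ v : V, x.im * ((x.im * x.im) * v) = (x.im * x.im) * (x.im * v) := fun v =>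
      LinearMap.congr_fun (commute_mulLeft_mulLeft_sq x.im).eq v
    have h1 := key y.re
    have h2 := key y.im
    have h3 := key2 y.re
    have h4 := key2 y.im
    have h5 := jordan_linearized x.re x.re x.im y.re
    have h6 := jordan_linearized x.re x.re x.im y.im
    have h7 := jordan_linearized x.im x.im x.re y.re
    have h8 := jordan_linearized x.im x.im x.re y.im
    clear key key2
    ext
    · simp only [re_mul, im_mul, mul_add, mul_sub, add_mul, sub_mul]
      simp only [mul_comm] at *
      grind
    · simp only [re_mul, im_mul, mul_add, mul_sub, add_mul, sub_mul]
      simp only [mul_comm] at *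
      grind

end Scalars

section Form

variable [EuclideanJordanAlgebra V]

/-- The complex bilinear extension of the inner product. -/
def cform : LinearMap.BilinForm ℂ (Cx V) :=
  LinearMap.mk₂ ℂ (fun x y => ⟨form x.re y.re - form x.im y.im, form x.re y.im + form x.im y.re⟩)
    (fun x y z => by apply Complex.ext <;> simp <;> ring)
    (fun a x y => by apply Complex.ext <;> simp <;> ring)
    (fun x y z => by apply Complex.ext <;> simp <;> ring)
    (fun a x y => by apply Complex.ext <;> simp <;> ring)

theorem cform_apply (x y : Cx V) :
    cform x y = ⟨form x.re y.re - form x.im y.im, form x.re y.im + form x.im y.re⟩ := rfl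

theorem cform_ofReal (x y : V) : cform (ofReal x) (ofReal y) = (form x y : ℂ) := by
  apply Complex.ext <;> simp [cform_apply]

theorem cform_symm (x y : Cx V) : cform x y = cform y x := by
  rw [cform_apply, cform_apply, form_symm x.re, form_symm x.im, form_symm x.re, form_symm x.im,
    add_comm (form y.im x.re)]

theorem cform_mul_left_comm (x y z : Cx V) : cform (x * y) z = cform y (x * z) := by
  rw [cform_apply, cform_apply]
  simp only [re_mul, im_mul, map_sub, map_add, LinearMap.sub_apply, LinearMap.add_apply,
    form_mul_left_comm]
  apply Complex.ext <;> simp only <;> ring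

theorem cform_quad (x y z : Cx V) : cform (quad x y) z = cform y (quad x z) := by
  simp only [quad, two_smul, map_sub, map_add, LinearMap.sub_apply, LinearMap.add_apply,
    cform_mul_left_comm]

/-- For w = x + iy the hypothesis gives x² + y² = 1; positivity of g on (1 - x)² and y² yields 2⟨g,
x⟩ ≤ tr g + ⟨g, x²⟩ ≤ 2 tr g. -/
theorem re_cform_le {g : V} (hg : IsPos g) {w : Cx V} (hw : w * w.conj = 1) :
    (cform (ofReal g) w).re ≤ tr g := by
  have h1 : w.re * w.re + w.im * w.im = 1 := by
    have := congrArg re hw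
    simpa using this
  have h2 := hg (1 - w.re)
  have h3 := hg w.im
  have h4 : form g (w.re * w.re) + form g (w.im * w.im) = tr g := by
    rw [← map_add, h1, tr]
  simp only [mul_sub, sub_mul, mul_one, one_mul, map_sub] at h2
  simp only [cform_apply, re_ofReal, im_ofReal, map_zero, LinearMap.zero_apply, sub_zero]
  rw [tr] at *
  linarith

theorem quad_smul (z : ℂ) (x y : Cx V) : quad x (z • y) = z • quad x y := by
  simp only [quad, two_smul, mul_smul_comm, smul_sub, smul_add]

theorem norm_cform_quad_le_of_unitary {ι κ : Type*} [Fintype ι] [Fintype κ] {c : ι → V} {d : κ → V}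
    (hc : IsCSOI c) (hd : IsCSOI d) {u : ι → ℂ} {v : κ → ℂ} (hu : ∀ i, ‖u i‖ = 1)
    (hv : ∀ i, ‖v i‖ = 1) {g : V} (hg : IsPos g) :
    ‖cform (ofReal g) (quad (diag (fun i => ofReal (c i)) u) (diag (fun i => ofReal (d i)) v))‖ ≤
      tr g := by
  have hre : ∀ v : κ → ℂ, (∀ i, ‖v i‖ = 1) → (cform (ofReal g)
      (quad (diag (fun i => ofReal (c i)) u) (diag (fun i => ofReal (d i)) v))).re ≤ tr g := by
    intro v hv
    apply re_cform_le hg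
    rw [conj_quad, conj_diag, conj_diag]
    have hinv : ∀ z : ℂ, ‖z‖ = 1 → starRingEnd ℂ z = z⁻¹ := fun z hz =>
      (Complex.inv_eq_conj hz).symm
    have hne : ∀ z : ℂ, ‖z‖ = 1 → z ≠ 0 := by
      rintro z hz rfl
      simp at hz
    simp only [hinv _ (hu _), hinv _ (hv _)]
    exact IsInv.mul_quad_quad (isInv_diag (isCSOI hc) fun i => hne _ (hu i))
      (isInv_diag (isCSOI hd) fun i => hne _ (hv i))
  set ζ := cform (ofReal g)
    (quad (diag (fun i => ofReal (c i)) u) (diag (fun i => ofReal (d i)) v)) with hζ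
  by_cases h0 : ζ = 0
  · have h1 := hre v hv
    rw [← hζ, h0] at h1
    simpa [h0] using h1
  have hn : (‖ζ‖ : ℂ) ≠ 0 := by simpa using h0
  -- A bound on real parts becomes a bound on the modulus by rotating v by this phase, since P_u v
  -- is linear in v.
  set l : ℂ := starRingEnd ℂ ζ / ‖ζ‖ with hl
  have hl1 : ‖l‖ = 1 := by
    rw [hl, norm_div]
    simp [h0]
  have hlz : l * ζ = ‖ζ‖ := by
    rw [hl, div_mul_eq_mul_div, Complex.conj_mul', sq, mul_div_assoc, div_self hn, mul_one]
  have h2 := hre (fun i => l * v i) fun i => by rw [norm_mul, hl1, hv, one_mul]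
  have h3 : diag (fun i => ofReal (d i)) (fun i => l * v i) =
      l • diag (fun i => ofReal (d i)) v := by
    simp [diag, Finset.smul_sum, mul_smul]
  rw [h3, quad_smul, map_smul, smul_eq_mul, ← hζ, hlz] at h2
  simpa using h2

/-- Zero coefficients arise from imaginary powers of singular elements. Such a v is the mean of two
unitaries, with the zeros replaced by 1 and by -1. -/
theorem norm_cform_quad_le {ι κ : Type*} [Fintype ι] [Fintype κ] {c : ι → V} {d : κ → V}
    (hc : IsCSOI c) (hd : IsCSOI d) {u : ι → ℂ} {v : κ → ℂ} (hu : ∀ i, ‖u i‖ = 1)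
    (hv : ∀ i, v i = 0 ∨ ‖v i‖ = 1) {g : V} (hg : IsPos g) :
    ‖cform (ofReal g) (quad (diag (fun i => ofReal (c i)) u) (diag (fun i => ofReal (d i)) v))‖ ≤
      tr g := by
  classical
  have key : ∀ a : ℂ, ‖a‖ = 1 → ‖cform (ofReal g) (quad (diag (fun i => ofReal (c i)) u)
      (diag (fun i => ofReal (d i)) (fun i => if v i = 0 then a else v i)))‖ ≤ tr g := by
    intro a ha
    refine norm_cform_quad_le_of_unitary hc hd hu (fun i => ?_) hg
    split_ifs with h
    · exact ha
    · exact (hv i).resolve_left h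
  have h1 := key 1 (by simp)
  have h2 := key (-1) (by simp)
  have h3 : diag (fun i => ofReal (d i)) v = (1 / 2 : ℂ) •
      (diag (fun i => ofReal (d i)) (fun i => if v i = 0 then 1 else v i) +
        diag (fun i => ofReal (d i)) (fun i => if v i = 0 then -1 else v i)) := by
    rw [diag, diag, diag, ← Finset.sum_add_distrib, Finset.smul_sum]
    refine Finset.sum_congr rfl fun i _ => ?_
    rw [← add_smul, smul_smul]
    congr 1
    split_ifs with h
    · simp [h]
    · ring
  have h4 : ∀ x y z : Cx V, quad x (y + z) = quad x y + quad x z := fun x y z =>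
    map_add (quadLin x) y z
  rw [h3, quad_smul, map_smul, h4, map_add, norm_smul]
  have h5 := norm_add_le (cform (ofReal g) (quad (diag (fun i => ofReal (c i)) u)
      (diag (fun i => ofReal (d i)) (fun i => if v i = 0 then 1 else v i))))
    (cform (ofReal g) (quad (diag (fun i => ofReal (c i)) u)
      (diag (fun i => ofReal (d i)) (fun i => if v i = 0 then -1 else v i))))
  have h6 : ‖(1 / 2 : ℂ)‖ = 1 / 2 := by norm_num
  rw [h6]
  linarith

end Form

end Cx

end Complexification

/-! ### Powers supported away from zero, and the three lines theorem. -/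

section ThreeLines

/-- Complex powers of a non-negative number, equal to `0` at `0`. -/
noncomputable def cpowZero (b : ℝ) (z : ℂ) : ℂ := if b = 0 then 0 else Complex.exp (z * Real.log b)

/-- Real powers of a non-negative number, equal to `0` at `0`. -/
noncomputable def rpowZero (b t : ℝ) : ℝ := if b = 0 then 0 else Real.exp (t * Real.log b)

theorem norm_cpowZero (b : ℝ) (z : ℂ) : ‖cpowZero b z‖ = rpowZero b z.re := by
  rw [cpowZero, rpowZero]
  split_ifs
  · simp
  · rw [Complex.norm_exp, Complex.re_mul_ofReal]

theorem cpowZero_ofReal (b t : ℝ) : cpowZero b t = (rpowZero b t : ℂ) := by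
  rw [cpowZero, rpowZero]
  split_ifs <;> simp

theorem cpowZero_add (b : ℝ) (z w : ℂ) : cpowZero b (z + w) = cpowZero b z * cpowZero b w := by
  rw [cpowZero, cpowZero, cpowZero]
  split_ifs
  · simp
  · rw [add_mul, Complex.exp_add]

theorem rpowZero_add (b t t' : ℝ) : rpowZero b (t + t') = rpowZero b t * rpowZero b t' := by
  rw [rpowZero, rpowZero, rpowZero]
  split_ifs
  · simp
  · rw [add_mul, Real.exp_add]

theorem rpowZero_eq_rpow {b t : ℝ} (hb : 0 ≤ b) (ht : t ≠ 0) : rpowZero b t = b ^ t := by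
  rw [rpowZero]
  split_ifs with h
  · rw [h, Real.zero_rpow ht]
  · rw [Real.rpow_def_of_pos (lt_of_le_of_ne hb (Ne.symm h)), mul_comm]

theorem rpowZero_one {b : ℝ} (hb : 0 ≤ b) : rpowZero b 1 = b := by
  rw [rpowZero_eq_rpow hb one_ne_zero, Real.rpow_one]

theorem rpowZero_pos {b : ℝ} (hb : b ≠ 0) (t : ℝ) : 0 < rpowZero b t := by
  rw [rpowZero, if_neg hb]
  exact Real.exp_pos _

theorem rpowZero_zero {b : ℝ} (hb : b ≠ 0) : rpowZero b 0 = 1 := by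
  simp [rpowZero, hb]

theorem differentiable_cpowZero (b : ℝ) : Differentiable ℂ (cpowZero b) := by
  unfold cpowZero
  split_ifs <;> fun_prop

theorem continuous_rpowZero (b : ℝ) : Continuous (rpowZero b) := by
  unfold rpowZero
  split_ifs <;> fun_prop

open Complex.HadamardThreeLines in
/-- The three lines theorem for exponential sums. -/
theorem norm_le_of_exponential_sum {τ : Type*} [Fintype τ] (M : τ → ℂ) (G : τ → ℂ → ℂ)
    (hG : ∀ i, Differentiable ℂ (G i)) (N : τ → ℝ → ℝ) (hN : ∀ i, Continuous (N i))
    (hGN : ∀ i z, ‖G i z‖ = N i z.re) {a b : ℝ}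
    (ha : ∀ z : ℂ, z.re = 0 → ‖∑ i, G i z * M i‖ ≤ a)
    (hb : ∀ z : ℂ, z.re = 1 → ‖∑ i, G i z * M i‖ ≤ b) {t : ℝ} (ht0 : 0 ≤ t) (ht1 : t ≤ 1) :
    ‖∑ i, G i t * M i‖ ≤ a ^ (1 - t) * b ^ t := by
  have hd : Differentiable ℂ fun z => ∑ i, G i z * M i := by fun_prop
  -- The norm of each exponential depends continuously on Re z alone, so compactness of [0, 1]
  -- bounds the sum on the whole strip.
  have hB : BddAbove ((norm ∘ fun z => ∑ i, G i z * M i) '' verticalClosedStrip 0 1) := by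
    have hc : Continuous fun t => ∑ i, N i t * ‖M i‖ := by fun_prop
    obtain ⟨K, hK⟩ := (isCompact_Icc (a := (0 : ℝ)) (b := 1)).bddAbove_image hc.continuousOn
    refine ⟨K, ?_⟩
    rintro _ ⟨z, hz, rfl⟩
    refine le_trans (norm_sum_le _ _) (le_trans (le_of_eq ?_) (hK ⟨z.re, hz, rfl⟩))
    exact Finset.sum_congr rfl fun i _ => by rw [norm_mul, hGN]
  have h := norm_le_interp_of_mem_verticalClosedStrip' (z := (t : ℂ)) zero_lt_one
    (by simp [verticalClosedStrip, ht0, ht1]) hd.diffContOnCl hB (fun z hz => ha z hz)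
    (fun z hz => hb z hz)
  simpa using h

end ThreeLines

/-! ### The Araki–Lieb–Thirring inequality by interpolation. -/

section ArakiLiebThirring

variable {V : Type*} [NonAssocCommRing V] [Module ℝ V] [EuclideanJordanAlgebra V]

open Cx

theorem cform_diag_left {ι : Type*} [Fintype ι] (e : ι → V) (w : ι → ℂ) (y : Cx V) :
    cform (diag (fun i => ofReal (e i)) w) y = ∑ i, w i * cform (ofReal (e i)) y := by
  simp [diag]

/-- This separates the scalars, which will depend on z, from constant coefficients, giving the shape
required by `norm_le_of_exponential_sum`. -/
theorem cform_quad_diag_expand {ι κ μ : Type*} [Fintype ι] [Fintype κ] [Fintype μ] (c : ι → Cx V)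
    (d : κ → Cx V) (e : μ → Cx V) (u : ι → ℂ) (v : κ → ℂ) (w : μ → ℂ) :
    cform (diag e w) (quad (diag c u) (diag d v)) =
      ∑ p : ((ι × ι) × κ) × μ, (((u p.1.1.1 * u p.1.1.2) * v p.1.2) * w p.2) *
        cform (e p.2) (c p.1.1.1 * (c p.1.1.2 * d p.1.2) + c p.1.1.1 * (c p.1.1.2 * d p.1.2) -
          c p.1.1.1 * c p.1.1.2 * d p.1.2) := by
  have h : quad (diag c u) (diag d v) = ∑ p : (ι × ι) × κ, ((u p.1.1 * u p.1.2) * v p.2) •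
      (c p.1.1 * (c p.1.2 * d p.2) + c p.1.1 * (c p.1.2 * d p.2) - c p.1.1 * c p.1.2 * d p.2) := by
    have hrev : ∀ f : κ → ι → ι → Cx V,
        ∑ k, ∑ j, ∑ i, f k j i = ∑ i, ∑ j, ∑ k, f k j i := by
      intro f
      rw [Finset.sum_comm]
      simp_rw [Finset.sum_comm (γ := κ)]
      exact Finset.sum_comm
    have h1 : diag c u * (diag c u * diag d v) = ∑ p : (ι × ι) × κ, ((u p.1.1 * u p.1.2) * v p.2) •
        (c p.1.1 * (c p.1.2 * d p.2)) := by
      simp only [diag, Finset.sum_mul, Finset.mul_sum, smul_mul_assoc, mul_smul_comm, mul_smul,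
        Fintype.sum_prod_type, Finset.smul_sum]
      rw [hrev]
      refine Finset.sum_congr rfl fun i _ => Finset.sum_congr rfl fun j _ =>
        Finset.sum_congr rfl fun k _ => ?_
      simp only [smul_smul]
      congr 1
      ring
    have h2 : diag c u * diag c u * diag d v = ∑ p : (ι × ι) × κ, ((u p.1.1 * u p.1.2) * v p.2) •
        (c p.1.1 * c p.1.2 * d p.2) := by
      simp only [diag, Finset.sum_mul, Finset.mul_sum, smul_mul_assoc, mul_smul_comm, mul_smul,
        Fintype.sum_prod_type, Finset.smul_sum]
      rw [hrev]
      refine Finset.sum_congr rfl fun i _ => Finset.sum_congr rfl fun j _ =>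
        Finset.sum_congr rfl fun k _ => ?_
      simp only [smul_smul]
      congr 1
      ring
    rw [quad, two_smul, h1, h2, ← Finset.sum_add_distrib, ← Finset.sum_sub_distrib]
    simp only [smul_add, smul_sub]
  rw [h]
  simp only [diag, map_sum, map_smul, LinearMap.sum_apply, LinearMap.smul_apply, smul_eq_mul,
    Fintype.sum_prod_type, Finset.mul_sum]
  refine Finset.sum_congr rfl fun i _ => Finset.sum_congr rfl fun j _ =>
    Finset.sum_congr rfl fun k _ => Finset.sum_congr rfl fun m _ => ?_
  ring

/-- The Araki–Lieb–Thirring inequality in a Euclidean Jordan algebra. -/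
theorem araki_lieb_thirring {ι κ : Type*} [Fintype ι] [Fintype κ] {c : ι → V} {d : κ → V}
    (hc : IsCSOI c) (hd : IsCSOI d) {α : ι → ℝ} {β : κ → ℝ} (hα : ∀ i, 0 < α i) (hβ : ∀ i, 0 ≤ β i)
    {r : ℝ} (hr : 1 ≤ r) {X : V}
    (hXdef : X = quad (diag c α) (diag d β)) (D : SpectralDecomposition X) :
    ∑ m, D.eigenvalue m ^ r * tr (D.proj m) ≤
      form (diag d fun l => β l ^ r) (diag c fun k => α k ^ (2 * r)) := by
  have hr0 : 0 < r := by linarith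
  have hβpos : IsPos (diag d β) := isPos_diag hd hβ
  have hX : IsPos X := hXdef ▸ hβpos.quad hc fun i => (hα i).ne'
  have hξ : ∀ m, 0 ≤ D.eigenvalue m := D.eigenvalue_nonneg hX
  set S := ∑ m, D.eigenvalue m ^ r * tr (D.proj m) with hS
  set Q := form (diag d fun l => β l ^ r) (diag c fun k => α k ^ (2 * r)) with hQ
  have htr : ∀ m, 0 ≤ tr (D.proj m) := fun m => by
    rw [D.csoi.tr_proj]; exact (D.csoi.form_self_pos m).le
  have hS0 : 0 ≤ S := Finset.sum_nonneg fun m _ => mul_nonneg (Real.rpow_nonneg (hξ m) _) (htr m)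
  let A : ι → ℂ → ℂ := fun k z => cpowZero (α k) (z * r)
  let B : κ → ℂ → ℂ := fun l z => cpowZero (β l) (z * r)
  let W : Fin D.d → ℂ → ℂ := fun m z => cpowZero (D.eigenvalue m) ((1 - z) * r)
  let F : ℂ → ℂ := fun z => cform (diag (fun m => ofReal (D.proj m)) fun m => W m z)
    (quad (diag (fun k => ofReal (c k)) fun k => A k z) (diag (fun l => ofReal (d l)) fun l => B l z))
  have hF0 : ∀ z : ℂ, z.re = 0 → ‖F z‖ ≤ S := by
    intro z hz
    simp only [F]
    rw [cform_diag_left]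
    refine (norm_sum_le _ _).trans (Finset.sum_le_sum fun m _ => ?_)
    rw [norm_mul]
    have h1 : ‖W m z‖ = D.eigenvalue m ^ r := by
      simp only [W]
      rw [norm_cpowZero, ← rpowZero_eq_rpow (hξ m) hr0.ne']
      simp [hz]
    rw [h1]
    refine mul_le_mul_of_nonneg_left ?_ (Real.rpow_nonneg (hξ m) _)
    refine norm_cform_quad_le hc hd (fun k => ?_) (fun l => ?_) (isPos_of_idem (D.csoi.idem m))
    · simp only [A]
      rw [norm_cpowZero]
      simp [hz, rpowZero_zero (hα k).ne']
    · simp only [B]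
      by_cases h0 : β l = 0
      · left; simp [cpowZero, h0]
      · right
        rw [norm_cpowZero]
        simp [hz, rpowZero_zero h0]
  have hF1 : ∀ z : ℂ, z.re = 1 → ‖F z‖ ≤ Q := by
    intro z hz
    have hz' : z = (1 : ℝ) + (z - 1) := by push_cast; ring
    let αr : ι → ℝ := fun k => rpowZero (α k) r
    -- Splits a^(zr) into a^r times the unitary a^((z-1)r); a^r is written as the square of a^(r/2)
    -- to suit `quad_diag_mul`.
    have hA : (fun k => A k z) = fun k => (rpowZero (α k) (r / 2) : ℂ) * (rpowZero (α k) (r / 2) : ℂ) *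
        A k (z - 1) := by
      ext k
      simp only [A]
      rw [← cpowZero_ofReal, ← cpowZero_add, ← cpowZero_add]
      congr 1
      push_cast; ring
    have hP : diag (fun k => ofReal (c k)) (fun k => (rpowZero (α k) (r / 2) : ℂ) *
        (rpowZero (α k) (r / 2) : ℂ)) = ofReal (diag c αr) := by
      rw [ofReal_diag]
      congr 1
      ext k
      simp only [αr]
      rw [← Complex.ofReal_mul, ← rpowZero_add, add_halves]
    simp only [F]
    -- By self-adjointness P moves onto the powers of X, which are imaginary here, while b^(zr)
    -- supplies the weights β^r.
    rw [← cform_quad, cform_symm, cform_diag_left]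
    have hQ' : Q = ∑ l, β l ^ r * tr (quad (diag c αr) (d l)) := by
      have h1 : (diag c fun k => α k ^ (2 * r)) = quad (diag c αr) 1 := by
        rw [quad_one, diag_mul_diag hc]
        congr 1
        ext k
        simp only [αr]
        rw [← rpowZero_add, ← rpowZero_eq_rpow (hα k).le (by positivity), two_mul]
      rw [hQ, h1]
      simp only [tr, form_quad]
      simp [diag]
    rw [hQ']
    refine (norm_sum_le _ _).trans (Finset.sum_le_sum fun l _ => ?_)
    rw [norm_mul]
    have h1 : ‖B l z‖ = β l ^ r := by
      simp only [B]
      rw [norm_cpowZero, ← rpowZero_eq_rpow (hβ l) hr0.ne']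
      simp [hz]
    rw [h1]
    refine mul_le_mul_of_nonneg_left ?_ (Real.rpow_nonneg (hβ l) _)
    rw [hA, quad_diag_mul (isCSOI hc), hP, ← cform_quad, ← ofReal_quad]
    refine norm_cform_quad_le hc D.csoi (fun k => ?_) (fun m => ?_)
      ((isPos_of_idem (hd.idem l)).quad hc fun k => (rpowZero_pos (hα k).ne' r).ne')
    · simp only [A]
      rw [norm_cpowZero]
      simp [hz, rpowZero_zero (hα k).ne']
    · simp only [W]
      by_cases h0 : D.eigenvalue m = 0
      · left; simp [cpowZero, h0]
      · right
        rw [norm_cpowZero]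
        simp [hz, rpowZero_zero h0]
  have hFt : F ((1 / r : ℝ) : ℂ) = (S : ℂ) := by
    have hA : (fun k => A k ((1 / r : ℝ) : ℂ)) = fun k => (α k : ℂ) := by
      ext k
      simp only [A]
      rw [← Complex.ofReal_mul, one_div_mul_cancel hr0.ne', cpowZero_ofReal, rpowZero_one (hα k).le]
    have hB : (fun k => B k ((1 / r : ℝ) : ℂ)) = fun k => (β k : ℂ) := by
      ext k
      simp only [B]
      rw [← Complex.ofReal_mul, one_div_mul_cancel hr0.ne', cpowZero_ofReal, rpowZero_one (hβ k)]
    simp only [F]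
    rw [hA, hB, ← ofReal_diag, ← ofReal_diag, ← ofReal_quad, cform_diag_left, hS]
    rw [Complex.ofReal_sum]
    refine Finset.sum_congr rfl fun m _ => ?_
    -- At r = 1 this is the support projection of X rather than 1, which is harmless because it is
    -- paired with X itself.
    have hW : W m ((1 / r : ℝ) : ℂ) = (rpowZero (D.eigenvalue m) (r - 1) : ℂ) := by
      simp only [W]
      rw [← cpowZero_ofReal]
      congr 1
      push_cast
      have : (r : ℂ) ≠ 0 := by exact_mod_cast hr0.ne'
      field_simp
    have h2 : D.eigenvalue m ^ r = rpowZero (D.eigenvalue m) (r - 1) * D.eigenvalue m := by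
      rw [← rpowZero_eq_rpow (hξ m) hr0.ne']
      have h3 := rpowZero_add (D.eigenvalue m) (r - 1) 1
      rwa [sub_add_cancel, rpowZero_one (hξ m)] at h3
    rw [← hXdef, hW, cform_ofReal, form_symm, D.form_proj, ← D.csoi.tr_proj, h2]
    push_cast
    ring
  have hthree : ‖F ((1 / r : ℝ) : ℂ)‖ ≤ S ^ (1 - 1 / r) * Q ^ (1 / r) := by
    simp only [F, cform_quad_diag_expand] at hF0 hF1 ⊢
    refine norm_le_of_exponential_sum _
      (fun (p : ((ι × ι) × κ) × Fin D.d) z => ((A p.1.1.1 z * A p.1.1.2 z) * B p.1.2 z) * W p.2 z)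
      (fun p => ?_)
      (fun p t => ((rpowZero (α p.1.1.1) (t * r) * rpowZero (α p.1.1.2) (t * r)) *
        rpowZero (β p.1.2) (t * r)) * rpowZero (D.eigenvalue p.2) ((1 - t) * r)) (fun p => ?_)
      (fun p z => ?_) hF0 hF1 (by positivity) ?_
    · simp only [A, B, W]
      have h1 : ∀ b : ℝ, Differentiable ℂ fun z : ℂ => cpowZero b (z * r) := fun b =>
        (differentiable_cpowZero b).comp (by fun_prop)
      have h2 : ∀ b : ℝ, Differentiable ℂ fun z : ℂ => cpowZero b ((1 - z) * r) := fun b =>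
        (differentiable_cpowZero b).comp (by fun_prop)
      exact (((h1 _).mul (h1 _)).mul (h1 _)).mul (h2 _)
    · have h1 : ∀ b : ℝ, Continuous fun t : ℝ => rpowZero b (t * r) := fun b =>
        (continuous_rpowZero b).comp (by fun_prop)
      have h2 : ∀ b : ℝ, Continuous fun t : ℝ => rpowZero b ((1 - t) * r) := fun b =>
        (continuous_rpowZero b).comp (by fun_prop)
      exact (((h1 _).mul (h1 _)).mul (h1 _)).mul (h2 _)
    · simp only [A, B, W, norm_mul, norm_cpowZero, Complex.re_mul_ofReal, Complex.sub_re,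
        Complex.one_re]
    · rw [div_le_one hr0]; exact hr
  have hQ0 : 0 ≤ Q := (norm_nonneg _).trans (hF1 1 (by simp))
  rw [hFt, Complex.norm_real, Real.norm_of_nonneg hS0] at hthree
  -- Assuming Q < S makes S positive, so the factor S^(1-1/r) can be used strictly.
  by_contra! hlt
  have hSpos : 0 < S := hQ0.trans_lt hlt
  have h1 : Q ^ (1 / r) < S ^ (1 / r) := Real.rpow_lt_rpow hQ0 hlt (by positivity)
  have h2 : S ^ (1 - 1 / r) * Q ^ (1 / r) < S ^ (1 - 1 / r) * S ^ (1 / r) :=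
    mul_lt_mul_of_pos_left h1 (Real.rpow_pos_of_pos hSpos _)
  rw [← Real.rpow_add hSpos, sub_add_cancel, Real.rpow_one] at h2
  linarith

end ArakiLiebThirring

/-! ### Reduction of the entropy comparison to the trace inequality. -/

section Renyi

variable {V : Type*} [NonAssocCommRing V] [Module ℝ V] [EuclideanJordanAlgebra V]

theorem fn_eq_diag {x : V} (D : SpectralDecomposition x) (f : ℝ → ℝ) :
    fn f x = diag D.proj fun i => f (D.eigenvalue i) := fn_eq_apply D f

theorem IsState.isPos {ρ : V} (h : IsState ρ) : IsPos ρ := by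
  obtain ⟨⟨x, rfl⟩, -⟩ := h
  exact isPos_sq x

theorem tr_diag {ι : Type*} [Fintype ι] (c : ι → V) (z : ι → ℝ) :
    tr (diag c z) = ∑ i, z i * tr (c i) := by
  simp [tr, diag]

/-- The trace inequality behind the comparison of the two entropies. -/
theorem tr_sandwiched_le {ρ σ : V} (hρ : IsState ρ) (hσ : IsState σ) (hsupp : SuppLE ρ σ) {s : ℝ}
    (hs : 0 < s) :
    0 < tr (pow (quad (pow σ (-s / (2 * (1 + s)))) ρ) (1 + s)) ∧
      tr (pow (quad (pow σ (-s / (2 * (1 + s)))) ρ) (1 + s)) ≤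
        tr (pow ρ (1 + s) * pow σ (-s)) := by
  classical
  obtain ⟨Dσ⟩ := nonempty_spectralDecomposition σ
  obtain ⟨Dρ⟩ := nonempty_spectralDecomposition ρ
  have hσ0 := Dσ.eigenvalue_nonneg hσ.isPos
  have hρ0 := Dρ.eigenvalue_nonneg hρ.isPos
  have hr : 0 < 1 + s := by linarith
  set t := -s / (2 * (1 + s)) with ht
  have ht0 : t ≠ 0 := by
    rw [ht]
    exact div_ne_zero (by linarith) (by positivity)
  have htr : t * (2 * (1 + s)) = -s := by rw [ht]; field_simp
  -- the support of `σ` and its complement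
  let p : Fin Dσ.d → ℝ := fun k => if Dσ.eigenvalue k = 0 then 0 else 1
  let p' : Fin Dσ.d → ℝ := fun k => if Dσ.eigenvalue k = 0 then 1 else 0
  -- Zero eigenvalues are replaced by 1 to make the element invertible; since ρ lives on the support
  -- of σ, P applied to ρ does not change.
  let α : Fin Dσ.d → ℝ := fun k => if Dσ.eigenvalue k = 0 then 1 else Dσ.eigenvalue k ^ t
  have hα : ∀ k, 0 < α k := by
    intro k
    simp only [α]
    split_ifs with h
    · exact one_pos
    · exact Real.rpow_pos_of_pos (lt_of_le_of_ne (hσ0 k) (Ne.symm h)) _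
  have hpρ : diag Dσ.proj p * ρ = ρ := by
    have h : supp σ = diag Dσ.proj p := fn_eq_diag Dσ _
    rw [← h]
    exact hsupp
  have hpow : pow σ t = diag Dσ.proj fun k => p k * p k * α k := by
    rw [pow, fn_eq_diag Dσ]
    congr 1
    ext k
    simp only [p, α]
    split_ifs with h
    · simp [h, Real.zero_rpow ht0]
    · simp
  have hX : quad (pow σ t) ρ = quad (diag Dσ.proj α) ρ := by
    have h1 : (diag Dσ.proj fun k => p k * p k) = diag Dσ.proj p := by
      congr 1
      ext k
      simp only [p]
      split_ifs <;> simp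
    rw [hpow, quad_diag_mul Dσ.csoi, quad_diag_comm Dσ.csoi, h1]
    congr 1
    rw [quad, diag_mul_diag Dσ.csoi, h1, hpρ, hpρ, two_smul, add_sub_cancel_right]
  rw [hX]
  obtain ⟨E⟩ := nonempty_spectralDecomposition (quad (diag Dσ.proj α) ρ)
  have hξ := E.eigenvalue_nonneg (hρ.isPos.quad Dσ.csoi fun k => (hα k).ne')
  have hlhs : tr (pow (quad (diag Dσ.proj α) ρ) (1 + s)) =
      ∑ m, E.eigenvalue m ^ (1 + s) * tr (E.proj m) := by
    rw [pow, fn_eq_diag E, tr_diag]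
  have htrE : ∀ m, 0 < tr (E.proj m) := fun m => by
    rw [E.csoi.tr_proj]; exact E.csoi.form_self_pos m
  constructor
  · rw [hlhs]
    refine Finset.sum_pos' (fun m _ => mul_nonneg (Real.rpow_nonneg (hξ m) _) (htrE m).le) ?_
    -- Otherwise P_a ρ = 0, and invertibility of P_a forces ρ = 0, against tr ρ = 1. Strict
    -- positivity is what the logarithm needs.
    by_contra! hall
    have hz : ∀ m, E.eigenvalue m = 0 := by
      intro m
      by_contra h
      have h1 : 0 < E.eigenvalue m ^ (1 + s) :=
        Real.rpow_pos_of_pos (lt_of_le_of_ne (hξ m) (Ne.symm h)) _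
      exact absurd (hall m (Finset.mem_univ m)) (not_le.2 (mul_pos h1 (htrE m)))
    have h0 : quadLin (diag Dσ.proj α) ρ = 0 := by
      rw [quadLin_apply]
      refine E.eq_diag.trans ?_
      simp [diag, hz]
    have h1 := LinearMap.congr_fun
      (isInv_diag Dσ.csoi fun k => (hα k).ne').quadLin_mul.2 ρ
    rw [Module.End.mul_apply, h0, map_zero] at h1
    have h2 := hρ.2
    rw [← Module.End.one_apply (R := ℝ) ρ, ← h1] at h2
    simp [tr] at h2
  · have hmain := araki_lieb_thirring Dσ.csoi Dρ.csoi hα hρ0 (r := 1 + s) (by linarith)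
      (congrArg (quad (diag Dσ.proj α)) Dρ.eq_diag) E
    rw [hlhs]
    refine hmain.trans (le_of_eq ?_)
    have hρpow : pow ρ (1 + s) = diag Dρ.proj fun l => Dρ.eigenvalue l ^ (1 + s) :=
      fn_eq_diag Dρ _
    -- The artificial eigenvalues 1 contribute the projection onto the kernel of σ, which pairs to
    -- zero with ρ^(1+s) by `hperp'`.
    have hσpow : (diag Dσ.proj fun k => α k ^ (2 * (1 + s))) = pow σ (-s) + diag Dσ.proj p' := by
      rw [pow, fn_eq_diag Dσ, diag, diag, diag, ← Finset.sum_add_distrib]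
      refine Finset.sum_congr rfl fun k _ => ?_
      rw [← add_smul]
      congr 1
      simp only [α, p']
      split_ifs with h
      · rw [h, Real.one_rpow, Real.zero_rpow (by linarith), zero_add]
      · rw [← Real.rpow_mul (hσ0 k), htr, add_zero]
    have hperp : form ρ (diag Dσ.proj p') = 0 := by
      have h1 : diag Dσ.proj p * diag Dσ.proj p' = 0 := by
        rw [diag_mul_diag Dσ.csoi]
        refine Finset.sum_eq_zero fun k _ => ?_
        simp only [p, p']
        split_ifs <;> simp
      rw [← hpρ, form_mul_left_comm, h1, map_zero]
    have hidem : diag Dσ.proj p' * diag Dσ.proj p' = diag Dσ.proj p' := by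
      rw [diag_mul_diag Dσ.csoi]
      congr 1
      ext k
      simp only [p']
      split_ifs <;> simp
    have hperp' : form (pow ρ (1 + s)) (diag Dσ.proj p') = 0 := by
      have h1 : form ρ (diag Dσ.proj p') =
          ∑ l, Dρ.eigenvalue l * form (Dρ.proj l) (diag Dσ.proj p') := by
        refine (congrArg (fun y => form y (diag Dσ.proj p')) Dρ.eq_sum).trans ?_
        simp
      -- The vanishing pairing with ρ is a sum of non-negative terms, so each vanishes, and this
      -- survives replacing eigenvalues by their powers.
      have h2 : ∀ l, 0 ≤ form (Dρ.proj l) (diag Dσ.proj p') := fun l =>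
        (isPos_of_idem (Dρ.csoi.idem l)).form_idem_nonneg hidem
      rw [hperp, eq_comm, Finset.sum_eq_zero_iff_of_nonneg
        fun l _ => mul_nonneg (hρ0 l) (h2 l)] at h1
      rw [hρpow]
      generalize diag Dσ.proj p' = e at *
      rw [diag, map_sum, LinearMap.sum_apply]
      refine Finset.sum_eq_zero fun l _ => ?_
      rw [map_smul, LinearMap.smul_apply, smul_eq_mul]
      rcases mul_eq_zero.1 (h1 l (Finset.mem_univ l)) with h | h
      · rw [h, Real.zero_rpow hr.ne', zero_mul]
      · rw [h, mul_zero]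
    rw [← hρpow, hσpow, map_add, hperp', add_zero, tr, form_assoc, mul_one]

end Renyi
end EuclideanJordanAlgebra
theorem corollary4p1 {V : Type*} [NonAssocCommRing V] [Module ℝ V] [EuclideanJordanAlgebra V]
    (ρ σ : V) (hρ : EuclideanJordanAlgebra.IsState ρ) (hσ : EuclideanJordanAlgebra.IsState σ)
    (s : ℝ) (hs : 0 < s) :
    EuclideanJordanAlgebra.petzRenyi s ρ σ ≥ EuclideanJordanAlgebra.sandwichedRenyi s ρ σ := by
  rw [EuclideanJordanAlgebra.petzRenyi, EuclideanJordanAlgebra.sandwichedRenyi]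
  split_ifs with h
  · obtain ⟨hpos, hle⟩ := EuclideanJordanAlgebra.tr_sandwiched_le hρ hσ h hs
    rw [ge_iff_le, EReal.coe_le_coe_iff]
    exact mul_le_mul_of_nonneg_left (Real.log_le_log hpos hle) (by positivity)
  · exact le_rfl
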